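/- Let $\mathcal O$ be a valuation ring with maximal ideal $\mathfrak m$, residue field $k=\mathcal O/\mathfrak m$, field of fractions $K$, and valuation $v\colon K\to\Lambda\cup\{\infty\}$ with value group $\Lambda=v(K^\times)\cong K^\times/\mathcal O^\times$; write $\Lambda_+=\{\alpha\in\Lambda:\alpha\ge 0\}$. For every $\alpha\in\Lambda_+\cup\{\infty\}$ fix $t_\alpha\in\mathcal O$ with $v(t_\alpha)=\alpha$, where $t_0=1$ (and so $t_\infty=0$). Let $\mathfrak k\subseteq\mathcal O^\times\setminus(1+\mathfrak m)$ be a set of representatives modulo $\mathfrak m$ of the elements of $k^\times\setminus\{1\}$. Write $[x,y]=xyx^{-1}y^{-1}$. Then the group $GL_2(\mathcal O)$ is generated by the matrices $$R(a)=\begin{pmatrix}a&0\\0&1\end{pmatrix}\ (a\in\mathcal O^\times\setminus\{1\}),\qquad S=\begin{pmatrix}-1&1\\0&1\end{pmatrix},\qquad J=\begin{pmatrix}0&-1\\-1&0\end{pmatrix},$$ and, with $R(1)=Z(1)=1$ and $Z(a):=(J\,R(a))^2$ for $a\in\mathcal O^\times\setminus\{1\}$, the following are defining relations of $GL_2(\mathcal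 O)$ with respect to these generators: 1. $R(a)R(b)=R(ab)$, $\ Z(a)Z(b)=Z(ab)$, $\ [R(a),Z(b)]=1$ for $a,b\in\mathcal O^\times\setminus\{1\}$; 2. $[S,Z(a)]=1$ for $a\in\mathcal O^\times\setminus\{1\}$, and $S^2=1$; 3. $[S,R(1-at_\alpha)]=R(a)\,[S,R(1-t_\alpha)]\,R(a)^{-1}$ for $\alpha\in\Lambda_+\setminus\{0\}$ and $a\in\mathcal O^\times\setminus\{1\}$; 4. $S\,R(a)\,S=R(1-a)\,S\,R\!\left(\frac{a}{a-1}\right)$ for $a\in\mathfrak k$; 5. $J^2=1$ and $(JS)^3=1$. That is, the group presented by the symbols $R(a)$ ($a\in\mathcal O^\times\setminus\{1\}$), $S$, $J$ and these relations is isomorphic to $GL_2(\mathcal O)$, by an isomorphism that sends each symbol to the matrix of the same name. -/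

import Mathlib

namespace GL2Pres

open scoped commutatorElement

section Matrices

variable {O : Type*} [CommRing O]

/-- The matrix `R(a) = diag(a, 1)`. -/
def Rmat (a : Oˣ) : Matrix.GeneralLinearGroup (Fin 2) O where
  val := !![(a : O), 0; 0, 1]
  inv := !![((a⁻¹ : Oˣ) : O), 0; 0, 1]
  val_inv := by simp [Matrix.one_fin_two]
  inv_val := by simp [Matrix.one_fin_two]

/-- The involution `S = (-1, 1; 0, 1)`. -/
def Smat : Matrix.GeneralLinearGroup (Fin 2) O where
  val := !![-1, 1; 0, 1]
  inv := !![-1, 1; 0, 1]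
  val_inv := by simp [Matrix.one_fin_two]
  inv_val := by simp [Matrix.one_fin_two]

/-- The involution `J = (0, -1; -1, 0)`. -/
def Jmat : Matrix.GeneralLinearGroup (Fin 2) O where
  val := !![0, -1; -1, 0]
  inv := !![0, -1; -1, 0]
  val_inv := by simp [Matrix.one_fin_two]
  inv_val := by simp [Matrix.one_fin_two]

end Matrices

section Generators

/-- The abstract generators: one symbol `R a` for every unit `a ≠ 1`, and the symbols `S`, `J`. -/
inductive Gen (O : Type*) [CommRing O] where
  | R (a : Oˣ) (ha : a ≠ 1) : Gen O
  | S : Gen O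
  | J : Gen O

variable {O : Type*} [CommRing O]

/-- The matrix that an abstract generator stands for. -/
def Gen.toMatrix : Gen O → Matrix.GeneralLinearGroup (Fin 2) O
  | .R a _ => Rmat a
  | .S => Smat
  | .J => Jmat

/-- The word `S`. -/
def wS : FreeGroup (Gen O) := FreeGroup.of Gen.S

/-- The word `J`. -/
def wJ : FreeGroup (Gen O) := FreeGroup.of Gen.J

open Classical in
/-- The word `R(a)`, with the convention `R(1) = 1`. -/
noncomputable def wR (a : Oˣ) : FreeGroup (Gen O) :=
  if h : a = 1 then 1 else FreeGroup.of (Gen.R a h)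

open Classical in
/-- The word `Z(a) := (J R(a))²` for `a ≠ 1`, with the convention `Z(1) = 1`. -/
noncomputable def wZ (a : Oˣ) : FreeGroup (Gen O) :=
  if a = 1 then 1 else (wJ * wR a) ^ 2

end Generators

section Representatives

/-- `t` chooses an element of `O` of each value in `Λ₊ ∪ {∞}`. Mathlib writes the value group
multiplicatively and with the reversed order: `ValuationRing.ValueGroup O K` is the set of
classes of elements of `K` modulo `Oˣ`, its `0` is `v(0) = ∞`, its `1` is `v(1) = 0`, and the values
of elements of `O` are the `α ≤ 1`. -/
structure IsValueSection (O K : Type*) [CommRing O] [IsDomain O] [ValuationRing O] [Field K]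
    [Algebra O K] [IsFractionRing O K] (t : ValuationRing.ValueGroup O K → O) : Prop where
  valuation_eq : ∀ α : ValuationRing.ValueGroup O K, α ≤ 1 →
    ValuationRing.valuation O K (algebraMap O K (t α)) = α
  map_one : t 1 = 1

/-- `𝔨` is a set of units of `O` that represents, without repetition, the elements of the residue
field other than `0` and `1`. -/
def IsResidueRepresentatives (O : Type*) [CommRing O] [IsLocalRing O] (𝔨 : Set Oˣ) : Prop :=
  Set.BijOn (fun a : Oˣ => IsLocalRing.residue O (a : O)) 𝔨
    {x : IsLocalRing.ResidueField O | x ≠ 0 ∧ x ≠ 1}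

end Representatives

section Relations

/-- `IsRelation O K t 𝔨 l r` says that `l = r` is one of the relations of the presentation.
The commutator is `⁅x, y⁆ = x y x⁻¹ y⁻¹`. In `comm_S_R` and `S_R_S` the auxiliary units are the
ones determined by the displayed equations. -/
inductive IsRelation (O K : Type*) [CommRing O] [IsDomain O] [ValuationRing O] [Field K]
    [Algebra O K] [IsFractionRing O K] (t : ValuationRing.ValueGroup O K → O) (𝔨 : Set Oˣ) :
    FreeGroup (Gen O) → FreeGroup (Gen O) → Prop
  /-- `R(a) R(b) = R(ab)` -/
  | R_mul (a b : Oˣ) (ha : a ≠ 1) (hb : b ≠ 1) : IsRelation O K t 𝔨 (wR a * wR b) (wR (a * b))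
  /-- `Z(a) Z(b) = Z(ab)` -/
  | Z_mul (a b : Oˣ) (ha : a ≠ 1) (hb : b ≠ 1) : IsRelation O K t 𝔨 (wZ a * wZ b) (wZ (a * b))
  /-- `[R(a), Z(b)] = 1` -/
  | comm_R_Z (a b : Oˣ) (ha : a ≠ 1) (hb : b ≠ 1) : IsRelation O K t 𝔨 ⁅wR a, wZ b⁆ 1
  /-- `[S, Z(a)] = 1` -/
  | comm_S_Z (a : Oˣ) (ha : a ≠ 1) : IsRelation O K t 𝔨 ⁅(wS : FreeGroup (Gen O)), wZ a⁆ 1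
  /-- `S² = 1` -/
  | S_sq : IsRelation O K t 𝔨 ((wS : FreeGroup (Gen O)) ^ 2) 1
  /-- `[S, R(1 - a t_α)] = R(a) [S, R(1 - t_α)] R(a)⁻¹`, where `α` is a positive finite value -/
  | comm_S_R (α : ValuationRing.ValueGroup O K) (hα0 : α ≠ 0) (hα1 : α < 1)
      (a : Oˣ) (ha : a ≠ 1) (u w : Oˣ) (hu : (u : O) = 1 - a * t α) (hw : (w : O) = 1 - t α) :
      IsRelation O K t 𝔨 ⁅(wS : FreeGroup (Gen O)), wR u⁆ (wR a * ⁅(wS : FreeGroup (Gen O)), wR w⁆ * (wR a)⁻¹)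
  /-- `S R(a) S = R(1 - a) S R(a / (a - 1))` for `a ∈ 𝔨` -/
  | S_R_S (a : Oˣ) (ha : a ∈ 𝔨) (b c : Oˣ) (hb : (b : O) = 1 - a)
      (hc : (c : O) * ((a : O) - 1) = a) :
      IsRelation O K t 𝔨 (wS * wR a * wS) (wR b * wS * wR c)
  /-- `J² = 1` -/
  | J_sq : IsRelation O K t 𝔨 ((wJ : FreeGroup (Gen O)) ^ 2) 1
  /-- `(J S)³ = 1` -/
  | JS_cube : IsRelation O K t 𝔨 ((wJ * wS : FreeGroup (Gen O)) ^ 3) 1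

/-- The set of relators `l r⁻¹`, for the relations `l = r` of the presentation. -/
def relators (O K : Type*) [CommRing O] [IsDomain O] [ValuationRing O] [Field K]
    [Algebra O K] [IsFractionRing O K] (t : ValuationRing.ValueGroup O K → O) (𝔨 : Set Oˣ) :
    Set (FreeGroup (Gen O)) :=
  {x | ∃ l r, IsRelation O K t 𝔨 l r ∧ x = l * r⁻¹}

end Relations

end GL2Pres

/-! In any group satisfying the relations there are elements `e x` behaving like the matrices `(1,
x; 0, 1)`: conjugates of `s * r (-1)` by `r u` for units, commutators of `s` with `r (1 - x)` for
nonunits. The main point is their additivity, `e_add`. Conjugation by `r` scales `x`, so it reduces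
to sums with first term `1`; the relation for `S R(a) S` settles one representative per residue
class, and adding nonunits covers the rest. The products `z a * r b * e x` are then closed under
multiplication.

The relation `(J S)³ = 1` rewrites `j * e u * j` for units `u` (`j_mul_e_unit_mul_j`). Hence every
element of the group has the shape `β * j * e y`, or `β * j * e y * j` with `y` a nonunit, where `β`
is Borel. These two shapes correspond to matrices whose lower left entry is a unit or a nonunit.
Comparing entries, a normal form over the identity matrix is trivial (`eq_one_of_isNormal`), which
gives injectivity. Over a local ring the bottom row of an invertible matrix contains a unit, which
gives surjectivity (`map_surjective`). -/

namespace GL2Pres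

open scoped commutatorElement

/-- Elements of a group `G` that satisfy the relations of the presentation of `GL₂(O)`, for a local
ring `O`. -/
structure RelationSystem (O G : Type*) [CommRing O] [Group G] where
  r : Oˣ →* G
  z : Oˣ →* G
  s : G
  j : G
  r_comm_z : ∀ a b, Commute (r a) (z b)
  s_comm_z : ∀ a, Commute s (z a)
  s_mul_s : s * s = 1
  j_mul_j : j * j = 1
  js_cube : (j * s) ^ 3 = 1
  jr_sq : ∀ a, (j * r a) ^ 2 = z a
  conj_commutator : ∀ (x : O) (a u w : Oˣ), ¬ IsUnit x → (u : O) = 1 - a * x → (w : O) = 1 - x →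
    ⁅s, r u⁆ = r a * ⁅s, r w⁆ * (r a)⁻¹
  -- Only some `a₀` in the residue class of `a` has to satisfy the relation.
  s_r_s : ∀ a b : Oˣ, (b : O) = 1 - a → ∃ a₀ b₀ c₀ : Oˣ, ¬ IsUnit ((a : O) - a₀) ∧
    (b₀ : O) = 1 - a₀ ∧ (c₀ : O) * (a₀ - 1) = a₀ ∧ s * r a₀ * s = r b₀ * s * r c₀

namespace RelationSystem

variable {O G : Type*} [CommRing O] [Group G] (M : RelationSystem O G)

lemma r_comm (a b : Oˣ) : M.r a * M.r b = M.r b * M.r a := by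
  rw [← map_mul, mul_comm, map_mul]

lemma r_neg_one_mul_self : M.r (-1) * M.r (-1) = 1 := by
  rw [← map_mul]; simp

lemma r_neg_one_inv : (M.r (-1))⁻¹ = M.r (-1) := by
  rw [inv_eq_iff_mul_eq_one, r_neg_one_mul_self]

lemma s_inv : M.s⁻¹ = M.s := by
  rw [inv_eq_iff_mul_eq_one, s_mul_s]

lemma j_mul_r (a : Oˣ) : M.j * M.r a = M.z a * M.r a⁻¹ * M.j := by
  have h := M.jr_sq a
  rw [pow_two, ← mul_assoc] at h
  rw [← h, map_inv, mul_inv_cancel_right, mul_assoc, M.j_mul_j, mul_one]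

lemma r_mul_j (a : Oˣ) : M.r a * M.j = M.j * (M.z a * M.r a⁻¹) := by
  calc M.r a * M.j = M.j * (M.j * M.r a) * M.j := by rw [← mul_assoc M.j, M.j_mul_j, one_mul]
    _ = M.j * (M.z a * M.r a⁻¹) * (M.j * M.j) := by rw [j_mul_r]; simp only [mul_assoc]
    _ = _ := by rw [M.j_mul_j, mul_one]

/-- `z a` is the product of `r a` and `j * r a * j` in either order, and conjugation by `j` swaps
these factors. -/
lemma j_comm_z (a : Oˣ) : Commute M.j (M.z a) := by
  have h1 : M.j * M.r a * M.j = M.z a * M.r a⁻¹ := by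
    rw [j_mul_r, mul_assoc, M.j_mul_j, mul_one]
  have h2 : M.z a = M.r a * (M.j * M.r a * M.j) := by
    rw [h1, ← mul_assoc, (M.r_comm_z a a).eq, mul_assoc, ← map_mul]; simp
  have h3 : M.z a = M.j * M.r a * M.j * M.r a := by
    rw [← M.jr_sq a, pow_two, ← mul_assoc]
  change M.j * M.z a = M.z a * M.j
  nth_rw 1 [h2]
  rw [h3]
  simp only [mul_assoc]

lemma j_mul_s_mul_j : M.j * M.s * M.j = M.s * M.j * M.s := by
  have h := M.js_cube
  have h' : M.j * M.s * M.j * (M.s * M.j * M.s) = 1 := by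
    rw [← h, pow_succ, pow_two]; group
  rw [mul_eq_one_iff_eq_inv.1 h', mul_inv_rev, mul_inv_rev, s_inv,
    inv_eq_of_mul_eq_one_left M.j_mul_j, mul_assoc]

variable [IsLocalRing O]

lemma isUnit_one_sub {x : O} (hx : ¬ IsUnit x) : IsUnit (1 - x) :=
  (IsLocalRing.isUnit_or_isUnit_one_sub_self x).resolve_left hx

lemma isUnit_add_of_not {u x : O} (hu : IsUnit u) (hx : ¬ IsUnit x) : IsUnit (u + x) := by
  by_contra h
  have := IsLocalRing.nonunits_add h (b := -x) (by simpa using hx)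
  simp only [add_neg_cancel_right] at this
  exact this hu

/-! ### Unipotent elements and their additivity -/

open Classical in
/-- The element that stands for the matrix `(1, x; 0, 1)`. -/
noncomputable def e (x : O) : G :=
  -- On matrices, `S R(-1)` is `(1, 1; 0, 1)` and `[S, R(w)]` is `(1, 1 - w; 0, 1)`.
  if h : IsUnit x then M.r h.unit * (M.s * M.r (-1)) * (M.r h.unit)⁻¹
  else ⁅M.s, M.r (isUnit_one_sub h).unit⁆

lemma e_unit (u : Oˣ) : M.e (u : O) = M.r u * (M.s * M.r (-1)) * (M.r u)⁻¹ := by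
  have h : IsUnit (u : O) := u.isUnit
  rw [e, dif_pos h]
  simp

lemma e_nonunit {x : O} (hx : ¬ IsUnit x) (u : Oˣ) (hu : (u : O) = 1 - x) :
    M.e x = ⁅M.s, M.r u⁆ := by
  rw [e, dif_neg hx]
  congr 2
  ext
  simp [hu]

lemma r_conj_e (a : Oˣ) (x : O) : M.r a * M.e x * (M.r a)⁻¹ = M.e (a * x) := by
  by_cases h : IsUnit x
  · obtain ⟨u, rfl⟩ := h
    rw [← Units.val_mul, e_unit, e_unit, map_mul]
    group
  · have h' : ¬ IsUnit (a * x) := by simpa using h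
    obtain ⟨u, hu⟩ := isUnit_one_sub h'
    obtain ⟨w, hw⟩ := isUnit_one_sub h
    rw [M.e_nonunit h w hw, M.e_nonunit h' u hu, M.conj_commutator x a u w h hu hw]

lemma e_one : M.e 1 = M.s * M.r (-1) := by
  simpa using M.e_unit 1

lemma s_eq : M.s = M.e 1 * M.r (-1) := by
  rw [e_one, mul_assoc, r_neg_one_mul_self, mul_one]

lemma e_neg (x : O) : M.e (-x) = M.r (-1) * M.e x * M.r (-1) := by
  conv_rhs => rw [← M.r_neg_one_inv]
  rw [M.r_neg_one_inv]
  nth_rw 2 [← M.r_neg_one_inv]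
  rw [r_conj_e]
  simp

lemma e_zero : M.e 0 = 1 := by
  rw [M.e_nonunit not_isUnit_zero 1 (by simp)]
  simp

lemma e_one_mul_neg {x : O} : M.e 1 * M.e (-x) = M.s * M.e x * M.r (-1) := by
  rw [e_neg, e_one]
  simp only [← mul_assoc]
  rw [mul_assoc M.s, r_neg_one_mul_self, mul_one]

/-- The leading `s` cancels the first letter of the commutator, leaving the conjugate that defines
`e` at the unit `1 - x`. -/
lemma e_one_sub {x : O} (hx : ¬ IsUnit x) : M.e 1 * M.e (-x) = M.e (1 - x) := by
  obtain ⟨u, hu⟩ := isUnit_one_sub hx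
  rw [e_one_mul_neg, ← hu, e_unit, M.e_nonunit hx u hu, commutatorElement_def, s_inv,
    ← map_inv M.r u]
  simp only [mul_assoc]
  rw [M.r_comm (-1), ← mul_assoc M.s, s_mul_s, one_mul]

lemma e_one_sub_unit (a b : Oˣ) (hb : (b : O) = 1 - a)
    (c : Oˣ) (hc : (c : O) * (a - 1) = a) (h : M.s * M.r a * M.s = M.r b * M.s * M.r c) :
    M.e 1 * M.e (-(a : O)) = M.e (1 - a) := by
  -- Since `a - 1 = -b`, the relation for `s * r a * s` becomes a conjugate of `s * r (-1)` by `r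
  -- b`.
  have hcb : c = -1 * (b⁻¹ * a) := by
    rw [eq_comm, neg_one_mul, neg_eq_iff_eq_neg, inv_mul_eq_iff_eq_mul]
    ext
    push_cast
    rw [hb]
    linear_combination -hc
  have h1 : M.s * M.r a * M.s * (M.r a)⁻¹ = M.r b * (M.s * M.r (-1)) * (M.r b)⁻¹ := by
    rw [h, hcb, map_mul, map_mul, map_inv]
    group
  rw [e_one_mul_neg, ← hb, e_unit, e_unit, ← h1]
  simp only [mul_assoc]
  rw [← map_inv M.r a, M.r_comm _ (-1), ← mul_assoc (M.r (-1)) (M.r (-1)),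
    r_neg_one_mul_self, one_mul]

lemma e_smul (a : Oˣ) {x y : O} (h : M.e x * M.e y = M.e (x + y)) :
    M.e (a * x) * M.e (a * y) = M.e (a * x + a * y) := by
  rw [← mul_add, ← r_conj_e, ← r_conj_e, ← r_conj_e, ← h]
  group

lemma e_unit_mul_nonunit (u : Oˣ) {x : O} (hx : ¬ IsUnit x) :
    M.e (u : O) * M.e x = M.e (u + x) := by
  have h := M.e_one_sub (x := -((u⁻¹ : Oˣ) * x)) (by simpa using hx)
  rw [neg_neg, sub_neg_eq_add] at h
  simpa using M.e_smul u h

/-- After multiplication by `e 1` on the left, every sum involved is a unit plus a nonunit. -/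
lemma e_nonunit_mul_nonunit {x y : O} (hx : ¬ IsUnit x) (hy : ¬ IsUnit y) :
    M.e x * M.e y = M.e (x + y) := by
  obtain ⟨w, hw⟩ := isUnit_add_of_not isUnit_one hx
  have h1 := M.e_unit_mul_nonunit 1 hx
  have h2 := M.e_unit_mul_nonunit w hy
  have h3 := M.e_unit_mul_nonunit 1 (IsLocalRing.nonunits_add hx hy)
  apply mul_left_cancel (a := M.e ((1 : Oˣ) : O))
  rw [h3, ← mul_assoc, h1, Units.val_one, ← hw, h2, hw, add_assoc]

lemma e_one_mul_neg_one : M.e 1 * M.e (-1) = 1 := by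
  rw [e_one_mul_neg, e_one, ← mul_assoc, s_mul_s, one_mul, r_neg_one_mul_self]

lemma e_inv (x : O) : M.e (-x) = (M.e x)⁻¹ := by
  rw [eq_comm, inv_eq_iff_mul_eq_one]
  by_cases h : IsUnit x
  · obtain ⟨u, rfl⟩ := h
    have := M.e_smul u (x := 1) (y := -1) (by simp [e_one_mul_neg_one, e_zero])
    simpa [e_zero] using this
  · rw [M.e_nonunit_mul_nonunit h (by simpa using h), add_neg_cancel, e_zero]

lemma e_unit_mul_unit_of_nonunit (u v : Oˣ) (h : ¬ IsUnit ((u : O) + v)) :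
    M.e (u : O) * M.e (v : O) = M.e (u + v) := by
  have := M.e_unit_mul_nonunit (-u) h
  rw [Units.val_neg, neg_add_cancel_left, e_inv] at this
  rw [← this, mul_inv_cancel_left]

/-- If `1 - a` is a unit, `a` differs by a nonunit from a representative `a₀` for which the sum is
known; otherwise the sum is itself a nonunit. -/
lemma e_one_mul_neg_unit (a : Oˣ) : M.e 1 * M.e (-(a : O)) = M.e (1 + -(a : O)) := by
  by_cases h : IsUnit (1 - (a : O))
  · obtain ⟨b, hb⟩ := h
    obtain ⟨a₀, b₀, c₀, h₀, hb₀, hc₀, hs⟩ := M.s_r_s a b hb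
    have h1 := M.e_one_sub_unit a₀ b₀ hb₀ c₀ hc₀ hs
    have h₀' : ¬ IsUnit (-((a : O) - a₀)) := by rwa [IsUnit.neg_iff]
    have h2 := M.e_unit_mul_nonunit (-a₀) h₀'
    have h3 := M.e_unit_mul_nonunit b₀ h₀'
    rw [hb₀, ← h1, mul_assoc] at h3
    rw [Units.val_neg] at h2
    rw [h2] at h3
    convert h3 using 2
    · congr 1; ring
    · ring
  · rw [sub_eq_add_neg] at h
    simpa using M.e_unit_mul_unit_of_nonunit 1 (-a) (by simpa using h)

lemma e_add (x y : O) : M.e (x + y) = M.e x * M.e y := by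
  by_cases hx : IsUnit x
  · obtain ⟨u, rfl⟩ := hx
    by_cases hy : IsUnit y
    · obtain ⟨v, rfl⟩ := hy
      have := M.e_smul u (M.e_one_mul_neg_unit (-(u⁻¹ * v)))
      simpa using this.symm
    · rw [e_unit_mul_nonunit _ _ hy]
  · by_cases hy : IsUnit y
    · obtain ⟨v, rfl⟩ := hy
      have := M.e_unit_mul_nonunit (-v) (x := -x) (by simpa using hx)
      rw [Units.val_neg, ← neg_add_rev, e_inv, e_inv, e_inv] at this
      rw [← inv_inj, ← this, mul_inv_rev]
    · rw [M.e_nonunit_mul_nonunit hx hy]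

lemma e_mul_r (x : O) (a : Oˣ) : M.e x * M.r a = M.r a * M.e ((a⁻¹ : Oˣ) * x) := by
  rw [← r_conj_e, map_inv]
  group

lemma e_comm_z (x : O) (a : Oˣ) : Commute (M.e x) (M.z a) := by
  by_cases h : IsUnit x
  · obtain ⟨u, rfl⟩ := h
    rw [e_unit]
    exact (((M.r_comm_z _ _).mul_left ((M.s_comm_z _).mul_left (M.r_comm_z _ _)))).mul_left
      (M.r_comm_z _ _).inv_left
  · obtain ⟨u, hu⟩ := isUnit_one_sub h
    rw [M.e_nonunit h u hu, commutatorElement_def]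
    exact (((M.s_comm_z _).mul_left (M.r_comm_z _ _)).mul_left (M.s_comm_z _).inv_left).mul_left
      (M.r_comm_z _ _).inv_left

/-! ### Borel elements and their interaction with `j` -/

/-- The elements that stand for upper triangular matrices. -/
def IsBorel (g : G) : Prop := ∃ (a b : Oˣ) (x : O), g = M.z a * M.r b * M.e x

variable {M} in
lemma IsBorel.mul {g h : G} (hg : M.IsBorel g) (hh : M.IsBorel h) : M.IsBorel (g * h) := by
  obtain ⟨a, b, x, rfl⟩ := hg
  obtain ⟨a', b', x', rfl⟩ := hh
  refine ⟨a * a', b * b', (b'⁻¹ : Oˣ) * x + x', ?_⟩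
  rw [map_mul, map_mul, e_add]
  calc M.z a * M.r b * M.e x * (M.z a' * M.r b' * M.e x')
      = M.z a * M.r b * (M.e x * M.z a') * M.r b' * M.e x' := by group
    _ = M.z a * (M.r b * M.z a') * (M.e x * M.r b') * M.e x' := by
      rw [(M.e_comm_z x a').eq]; group
    _ = _ := by rw [e_mul_r, (M.r_comm_z b a').eq]; group

lemma isBorel_z (a : Oˣ) : M.IsBorel (M.z a) := ⟨a, 1, 0, by simp [e_zero]⟩

lemma isBorel_r (a : Oˣ) : M.IsBorel (M.r a) := ⟨1, a, 0, by simp [e_zero]⟩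

lemma isBorel_e (x : O) : M.IsBorel (M.e x) := ⟨1, 1, x, by simp⟩

/-- This is the braid relation `j_mul_s_mul_j` with `s` replaced by `e 1 * r (-1)`. -/
lemma j_mul_e_one_mul_j : M.j * M.e 1 * M.j = M.e 1 * M.r (-1) * M.z (-1) * M.j * M.e 1 := by
  calc M.j * M.e 1 * M.j = M.j * M.s * (M.r (-1) * M.j) := by rw [e_one]; group
    _ = M.j * M.s * (M.j * (M.j * M.r (-1)) * M.j) := by rw [← mul_assoc M.j M.j, M.j_mul_j, one_mul]
    _ = M.j * M.s * M.j * (M.z (-1) * M.r (-1)) * (M.j * M.j) := by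
      rw [j_mul_r, inv_neg, inv_one]; group
    _ = M.s * M.j * (M.s * M.z (-1)) * M.r (-1) := by
      rw [j_mul_s_mul_j, M.j_mul_j]; group
    _ = M.s * (M.j * M.z (-1)) * (M.s * M.r (-1)) := by
      rw [(M.s_comm_z _).eq]; group
    _ = _ := by rw [(M.j_comm_z _).eq, ← e_one, s_eq]; group

/-- On matrices the left side is `(1, 0; u, 1)`, which lies in the big cell because `u` is a unit.
The case `u = 1` is carried over by conjugation with `r u`. -/
lemma j_mul_e_unit_mul_j (u : Oˣ) :
    ∃ β, M.IsBorel β ∧ M.j * M.e (u : O) * M.j = β * M.j * M.e ((u⁻¹ : Oˣ) : O) := by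
  have hu : M.e (u : O) = M.r u * M.e 1 * M.r u⁻¹ := by rw [map_inv, r_conj_e, mul_one]
  have hj : M.r u⁻¹ * M.j = M.j * (M.z u⁻¹ * M.r u) := by
    rw [r_mul_j, inv_inv]
  refine ⟨M.z u * M.r u⁻¹ * (M.e 1 * M.r (-1) * M.z (-1)) * M.z u⁻¹ * (M.z u * M.r u⁻¹), ?_, ?_⟩
  · exact ((((M.isBorel_z _).mul (M.isBorel_r _)).mul (((M.isBorel_e _).mul
      (M.isBorel_r _)).mul (M.isBorel_z _))).mul (M.isBorel_z _)).mul
      ((M.isBorel_z _).mul (M.isBorel_r _))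
  · calc M.j * M.e (u : O) * M.j = M.j * M.r u * M.e 1 * (M.r u⁻¹ * M.j) := by rw [hu]; group
      _ = M.z u * M.r u⁻¹ * (M.j * M.e 1 * M.j) * (M.z u⁻¹ * M.r u) := by
        rw [hj, j_mul_r]; group
      _ = M.z u * M.r u⁻¹ * (M.e 1 * M.r (-1) * M.z (-1)) * M.j * (M.e 1 * M.z u⁻¹) * M.r u := by
        rw [j_mul_e_one_mul_j]; group
      _ = M.z u * M.r u⁻¹ * (M.e 1 * M.r (-1) * M.z (-1)) * (M.j * M.z u⁻¹) * (M.e 1 * M.r u) := by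
        rw [(M.e_comm_z _ _).eq]; group
      _ = M.z u * M.r u⁻¹ * (M.e 1 * M.r (-1) * M.z (-1)) * M.z u⁻¹ * (M.j * M.r u) *
          M.e ((u⁻¹ : Oˣ) : O) := by
        rw [(M.j_comm_z _).eq, M.e_mul_r 1 u, mul_one]; simp only [mul_assoc]
      _ = _ := by rw [j_mul_r]; group

/-- This keeps the smaller cell stable under `e 1`. On matrices, `(1, 0; y, 1)` times `(1, 1; 0, 1)`
is upper triangular times `(1, 0; q, 1)` with `q = y / (1 + y)`. -/
lemma j_e_j_e_one {y : O} (hy : ¬ IsUnit y) :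
    ∃ β q, M.IsBorel β ∧ ¬ IsUnit q ∧ M.j * M.e y * M.j * M.e 1 = β * M.j * M.e q * M.j := by
  obtain ⟨u, hu⟩ := isUnit_add_of_not isUnit_one hy
  obtain ⟨β, hβ, h⟩ := M.j_mul_e_unit_mul_j u
  have hr : M.r (-1) * M.j = M.j * M.z (-1) * M.r (-1) := by
    rw [r_mul_j, inv_neg, inv_one, mul_assoc]
  refine ⟨β * M.z (-1) * M.r (-1), 1 - (u⁻¹ : Oˣ), (hβ.mul (M.isBorel_z _)).mul (M.isBorel_r _),
    ?_, ?_⟩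
  · have : (1 : O) - (u⁻¹ : Oˣ) = (u⁻¹ : Oˣ) * y := by
      have : (y : O) = u - 1 := by rw [hu]; ring
      rw [this, mul_sub]; simp
    rw [this]
    simpa using hy
  -- Inserting `j * j` creates `j * e 1 * j`; expanding it merges `e y * e 1` into `e u` with `u = 1
  -- + y` a unit.
  · calc M.j * M.e y * M.j * M.e 1 = M.j * M.e y * (M.j * M.e 1 * M.j) * M.j := by
          simp only [mul_assoc, M.j_mul_j, mul_one]
      _ = M.j * (M.e y * M.e 1) * M.r (-1) * (M.z (-1) * M.j) * M.e 1 * M.j := by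
        rw [j_mul_e_one_mul_j]; group
      _ = M.j * M.e (u : O) * (M.r (-1) * M.j) * M.z (-1) * M.e 1 * M.j := by
        rw [← e_add, add_comm y, ← hu, ← (M.j_comm_z _).eq]; group
      _ = (M.j * M.e (u : O) * M.j) * M.z (-1) * (M.r (-1) * M.z (-1)) * M.e 1 * M.j := by
        rw [hr]; group
      _ = (M.j * M.e (u : O) * M.j) * (M.z (-1) * M.z (-1)) * M.r (-1) * M.e 1 * M.j := by
        rw [(M.r_comm_z _ _).eq]; group
      _ = β * M.j * (M.e ((u⁻¹ : Oˣ) : O) * M.r (-1)) * M.e 1 * M.j := by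
        rw [← map_mul, h]; simp; group
      _ = β * (M.j * M.r (-1)) * (M.e (-((u⁻¹ : Oˣ) : O)) * M.e 1) * M.j := by
        rw [e_mul_r]; simp; group
      _ = _ := by
        rw [← e_add, j_mul_r, neg_add_eq_sub]; simp; group

/-! ### Normal forms and their stability under the generators -/

/-- The normal form of an element of the group that is generated by the relation system. -/
def IsNormal (g : G) : Prop :=
  ∃ β y, M.IsBorel β ∧ (g = β * M.j * M.e y ∨ (¬ IsUnit y ∧ g = β * M.j * M.e y * M.j))

variable {M}

lemma IsNormal.mul_r {g : G} (hg : M.IsNormal g) (a : Oˣ) : M.IsNormal (g * M.r a) := by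
  have key (a : Oˣ) (y : O) : M.j * M.e y * M.r a = M.z a * M.r a⁻¹ * M.j * M.e ((a⁻¹ : Oˣ) * y) := by
    rw [mul_assoc, e_mul_r, ← mul_assoc, j_mul_r]
  obtain ⟨β, y, hβ, rfl | ⟨hy, rfl⟩⟩ := hg
  · refine ⟨β * (M.z a * M.r a⁻¹), (a⁻¹ : Oˣ) * y,
      hβ.mul ((M.isBorel_z _).mul (M.isBorel_r _)), Or.inl ?_⟩
    rw [mul_assoc β, mul_assoc β, key]
    simp only [mul_assoc]
  · refine ⟨β * (M.z a * (M.z a⁻¹ * M.r a)), a * y, hβ.mul ((M.isBorel_z _).mul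
      ((M.isBorel_z _).mul (M.isBorel_r _))), Or.inr ⟨by simpa using hy, ?_⟩⟩
    calc β * M.j * M.e y * M.j * M.r a = β * M.j * M.e y * (M.j * M.r a) := by
          simp only [mul_assoc]
      _ = β * M.j * (M.e y * M.z a) * M.r a⁻¹ * M.j := by rw [j_mul_r]; simp only [mul_assoc]
      _ = β * (M.j * M.z a) * M.e y * M.r a⁻¹ * M.j := by
        rw [(M.e_comm_z y a).eq]; simp only [mul_assoc]
      _ = β * M.z a * (M.j * M.e y * M.r a⁻¹) * M.j := by
        rw [(M.j_comm_z a).eq]; simp only [mul_assoc]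
      _ = _ := by rw [key a⁻¹, inv_inv]; simp only [mul_assoc]

lemma IsNormal.mul_j {g : G} (hg : M.IsNormal g) : M.IsNormal (g * M.j) := by
  obtain ⟨β, y, hβ, rfl | ⟨hy, rfl⟩⟩ := hg
  · by_cases hy : IsUnit y
    · obtain ⟨u, rfl⟩ := hy
      obtain ⟨γ, hγ, h⟩ := M.j_mul_e_unit_mul_j u
      refine ⟨β * γ, (u⁻¹ : Oˣ), hβ.mul hγ, Or.inl ?_⟩
      rw [mul_assoc β, mul_assoc β, h]
      simp only [mul_assoc]
    · exact ⟨β, y, hβ, Or.inr ⟨hy, rfl⟩⟩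
  · refine ⟨β, y, hβ, Or.inl ?_⟩
    rw [mul_assoc _ M.j M.j, M.j_mul_j, mul_one]

lemma IsNormal.mul_s {g : G} (hg : M.IsNormal g) : M.IsNormal (g * M.s) := by
  rw [s_eq, ← mul_assoc]
  refine IsNormal.mul_r ?_ _
  obtain ⟨β, y, hβ, rfl | ⟨hy, rfl⟩⟩ := hg
  · refine ⟨β, y + 1, hβ, Or.inl ?_⟩
    rw [e_add, mul_assoc _ (M.e y)]
  · obtain ⟨γ, q, hγ, hq, h⟩ := M.j_e_j_e_one hy
    refine ⟨β * γ, q, hβ.mul hγ, Or.inr ⟨hq, ?_⟩⟩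
    calc _ = β * (M.j * M.e y * M.j * M.e 1) := by group
      _ = _ := by rw [h]; group

lemma isNormal_one : M.IsNormal 1 :=
  ⟨1, 0, by simpa using M.isBorel_z 1, Or.inr ⟨not_isUnit_zero, by simp [e_zero, M.j_mul_j]⟩⟩

variable (M)

lemma isNormal_of_closure_eq_top (h : Subgroup.closure (Set.range M.r ∪ {M.s, M.j}) = ⊤) (g : G) :
    M.IsNormal g := by
  have hg : g ∈ Subgroup.closure (Set.range M.r ∪ {M.s, M.j}) := h ▸ Subgroup.mem_top g
  have hj : M.j⁻¹ = M.j := inv_eq_of_mul_eq_one_left M.j_mul_j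
  induction hg using Subgroup.closure_induction_right with
  | one => exact isNormal_one
  | mul_right g hg y hy ih =>
    obtain ⟨a, rfl⟩ | rfl | rfl := hy
    · exact ih.mul_r a
    · exact ih.mul_s
    · exact ih.mul_j
  | mul_inv_cancel g hg y hy ih =>
    obtain ⟨a, rfl⟩ | rfl | rfl := hy
    · rw [← map_inv]
      exact ih.mul_r _
    · rw [s_inv]
      exact ih.mul_s
    · rw [hj]
      exact ih.mul_j

end RelationSystem

/-! ### Matrix computations -/

section MatrixIdentities

variable {O : Type*} [CommRing O]

@[simp] lemma coe_Rmat (a : Oˣ) : (Rmat a).val = !![(a : O), 0; 0, 1] := rfl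

@[simp] lemma coe_Smat : (Smat : Matrix.GeneralLinearGroup (Fin 2) O).val = !![-1, 1; 0, 1] := rfl

@[simp] lemma coe_Jmat : (Jmat : Matrix.GeneralLinearGroup (Fin 2) O).val = !![0, -1; -1, 0] := rfl

lemma inv_Rmat (a : Oˣ) : (Rmat a)⁻¹ = Rmat a⁻¹ := rfl

lemma inv_Smat : (Smat : Matrix.GeneralLinearGroup (Fin 2) O)⁻¹ = Smat := rfl

lemma Rmat_one : Rmat (1 : Oˣ) = 1 := by
  apply Units.ext
  simp [Matrix.one_fin_two]

lemma Rmat_mul (a b : Oˣ) : Rmat a * Rmat b = Rmat (a * b) := by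
  apply Units.ext
  simp

lemma coe_Jmat_mul_Rmat_sq (a : Oˣ) : ((Jmat * Rmat a) ^ 2).val = !![(a : O), 0; 0, a] := by
  simp [pow_two]

lemma coe_commutator_Smat_Rmat (a : Oˣ) : (⁅(Smat : Matrix.GeneralLinearGroup (Fin 2) O), Rmat a⁆).val =
    !![1, 1 - (a : O); 0, 1] := by
  rw [commutatorElement_def, inv_Rmat, inv_Smat]
  simp [sub_eq_neg_add]

end MatrixIdentities

/-! ### Injectivity on normal forms, and surjectivity -/

namespace RelationSystem

variable {O G : Type*} [CommRing O] [Group G] (M : RelationSystem O G)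
  {f : G →* Matrix.GeneralLinearGroup (Fin 2) O} (hr : ∀ a, f (M.r a) = Rmat a)
  (hs : f M.s = Smat) (hj : f M.j = Jmat)

include hr hj in
lemma coe_map_z (a : Oˣ) : (f (M.z a)).val = !![(a : O), 0; 0, a] := by
  rw [← M.jr_sq, map_pow, map_mul, hr, hj, coe_Jmat_mul_Rmat_sq]

variable [IsLocalRing O]

include hr hs in
lemma coe_map_e (x : O) : (f (M.e x)).val = !![1, x; 0, 1] := by
  by_cases h : IsUnit x
  · obtain ⟨u, rfl⟩ := h
    rw [e_unit]
    simp [hr, hs, inv_Rmat]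
  · obtain ⟨u, hu⟩ := isUnit_one_sub h
    rw [M.e_nonunit h u hu, map_commutatorElement, hr, hs, coe_commutator_Smat_Rmat, hu,
      sub_sub_cancel]

include hr hs hj in
lemma coe_map_normal (a b : Oˣ) (x y : O) :
    (f (M.z a * M.r b * M.e x * M.j * M.e y)).val =
      !![-(a * b * x), -(a * b + a * b * x * y); -(a : O), -(a * y)] := by
  simp only [map_mul, Units.val_mul, M.coe_map_z hr hj, M.coe_map_e hr hs, hr, hj, coe_Rmat,
    coe_Jmat]
  ext i k
  fin_cases i <;> fin_cases k <;> simp [mul_assoc]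

include hr hs hj in
-- The first shape has the unit `-a` as lower left entry. In the second, the bottom row forces `a =
-- 1` and `y = 0`, then the top row `b = 1` and `x = 0`.
lemma eq_one_of_isNormal {g : G} (hg : M.IsNormal g) (h : f g = 1) : g = 1 := by
  obtain ⟨_, y, ⟨a, b, x, rfl⟩, rfl | ⟨hy, rfl⟩⟩ := hg
  · have h1 := congrArg (fun A : Matrix.GeneralLinearGroup (Fin 2) O => A.val 1 0) h
    simp only [M.coe_map_normal hr hs hj] at h1
    simp at h1
  · rw [map_mul, hj, mul_eq_one_iff_eq_inv] at h
    have h1 := congrArg Units.val h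
    rw [M.coe_map_normal hr hs hj] at h1
    have h2 : (Jmat⁻¹ : Matrix.GeneralLinearGroup (Fin 2) O).val = !![0, -1; -1, 0] := rfl
    rw [h2] at h1
    have h00 := congrFun (congrFun h1 0) 0
    have h01 := congrFun (congrFun h1 0) 1
    have h10 := congrFun (congrFun h1 1) 0
    have h11 := congrFun (congrFun h1 1) 1
    simp at h00 h01 h10 h11
    subst h10 h11
    simp at h00 h01
    subst h00 h01
    simp [e_zero, M.j_mul_j]

include hr hs hj in
lemma exists_map_eq_of_isUnit (A : Matrix.GeneralLinearGroup (Fin 2) O) (h : IsUnit (A.val 1 0)) :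
    ∃ g, f g = A := by
  obtain ⟨c, hc⟩ := h
  obtain ⟨D, hD⟩ : IsUnit A.val.det := (Matrix.isUnit_iff_isUnit_det _).1 A.isUnit
  rw [Matrix.det_fin_two, ← hc] at hD
  -- Solves `coe_map_normal` for `A`: the bottom row gives `a` and `y`, the determinant `-a²b` gives
  -- `b`, the upper left entry gives `x`.
  refine ⟨M.z (-c) * M.r (-(D * c⁻¹ * c⁻¹)) * M.e (-(A.val 0 0 * D⁻¹.val * c)) * M.j *
    M.e (c⁻¹.val * A.val 1 1), ?_⟩
  apply Units.ext
  rw [M.coe_map_normal hr hs hj]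
  have hc' := c.mul_inv
  have hD' := D.mul_inv
  ext i k
  have h00 : (c : O) * (D * c⁻¹.val * c⁻¹.val) * (A.val 0 0 * D⁻¹.val * c) = A.val 0 0 := by
    linear_combination A.val 0 0 * (c * c⁻¹.val + 1) * (D * D⁻¹.val) * hc' + A.val 0 0 * hD'
  fin_cases i <;> fin_cases k
  · simpa using h00
  · simp
    linear_combination (c⁻¹.val * A.val 1 1) * h00 - D * c⁻¹.val * hc' - c⁻¹.val * hD +
      A.val 0 1 * hc'
  · simpa using hc
  · simp

include hr hs hj in
lemma map_surjective : Function.Surjective f := by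
  intro A
  by_cases h : IsUnit (A.val 1 0)
  · exact M.exists_map_eq_of_isUnit hr hs hj A h
  · have hd : IsUnit (A.val 1 1) := by
      by_contra hd
      have hD : IsUnit A.val.det := (Matrix.isUnit_iff_isUnit_det _).1 A.isUnit
      rw [Matrix.det_fin_two, sub_eq_add_neg] at hD
      exact IsLocalRing.nonunits_add (a := A.val 0 0 * A.val 1 1)
        (b := -(A.val 0 1 * A.val 1 0)) (by simp [hd]) (by simp [h]) hD
    -- Right multiplication by `Jmat` swaps the columns up to sign, moving the unit to the lower
    -- left.
    obtain ⟨g, hg⟩ := M.exists_map_eq_of_isUnit hr hs hj (A * Jmat) (by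
      simpa [Matrix.mul_apply, Fin.sum_univ_two] using hd)
    refine ⟨g * M.j, ?_⟩
    rw [map_mul, hg, hj, mul_assoc, ← hj, ← map_mul, M.j_mul_j, map_one, mul_one]

end RelationSystem

/-! ### Values of the words in matrices -/

section Evaluation

variable {O : Type*} [CommRing O]

lemma wR_one : wR (1 : Oˣ) = 1 := dif_pos rfl

lemma wZ_one : wZ (1 : Oˣ) = 1 := if_pos rfl

lemma wZ_of_ne {a : Oˣ} (ha : a ≠ 1) : wZ a = (wJ * wR a) ^ 2 := if_neg ha

lemma lift_wR (a : Oˣ) : FreeGroup.lift Gen.toMatrix (wR a) = Rmat a := by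
  unfold wR
  split_ifs with h
  · rw [map_one, h, Rmat_one]
  · rw [FreeGroup.lift_apply_of]
    rfl

lemma lift_wS : FreeGroup.lift Gen.toMatrix (wS : FreeGroup (Gen O)) = Smat := by
  rw [wS, FreeGroup.lift_apply_of]
  rfl

lemma lift_wJ : FreeGroup.lift Gen.toMatrix (wJ : FreeGroup (Gen O)) = Jmat := by
  rw [wJ, FreeGroup.lift_apply_of]
  rfl

lemma coe_lift_wZ (a : Oˣ) :
    (FreeGroup.lift Gen.toMatrix (wZ a)).val = !![(a : O), 0; 0, a] := by
  unfold wZ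
  split_ifs with h
  · simp [h, Matrix.one_fin_two]
  · rw [map_pow, map_mul, lift_wJ, lift_wR, coe_Jmat_mul_Rmat_sq]

end Evaluation

/-! ### The presented group as a relation system -/

section Presentation

variable {O K : Type*} [CommRing O] [IsDomain O] [ValuationRing O] [Field K] [Algebra O K]
  [IsFractionRing O K] {t : ValuationRing.ValueGroup O K → O} {𝔨 : Set Oˣ}

lemma IsRelation.lift_eq {l r : FreeGroup (Gen O)} (h : IsRelation O K t 𝔨 l r) :
    FreeGroup.lift Gen.toMatrix l = FreeGroup.lift Gen.toMatrix r := by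
  cases h with
  | R_mul a b ha hb => simp only [map_mul, lift_wR, Rmat_mul]
  | Z_mul a b ha hb =>
    apply Units.ext
    simp [coe_lift_wZ]
  | comm_R_Z a b ha hb =>
    rw [map_commutatorElement, map_one, commutatorElement_eq_one_iff_mul_comm]
    apply Units.ext
    simp [coe_lift_wZ, lift_wR, mul_comm]
  | comm_S_Z a ha =>
    rw [map_commutatorElement, map_one, commutatorElement_eq_one_iff_mul_comm]
    apply Units.ext
    simp [coe_lift_wZ, lift_wS]
  | S_sq =>
    apply Units.ext
    simp [lift_wS, pow_two, Matrix.one_fin_two]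
  | comm_S_R α hα0 hα1 a ha u w hu hw =>
    apply Units.ext
    simp [map_commutatorElement, lift_wS, lift_wR, coe_commutator_Smat_Rmat, inv_Rmat, hu, hw]
  | S_R_S a ha b c hb hc =>
    apply Units.ext
    simp only [map_mul, lift_wS, lift_wR, Units.val_mul, coe_Smat, coe_Rmat, hb]
    simp
    constructor
    · linear_combination -hc
    · ring
  | J_sq =>
    apply Units.ext
    simp [lift_wJ, pow_two, Matrix.one_fin_two]
  | JS_cube =>
    apply Units.ext
    simp [lift_wJ, lift_wS, pow_succ, Matrix.one_fin_two]

lemma IsRelation.mk_eq {l r : FreeGroup (Gen O)} (h : IsRelation O K t 𝔨 l r) :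
    PresentedGroup.mk (relators O K t 𝔨) l = PresentedGroup.mk (relators O K t 𝔨) r := by
  rw [← mul_inv_eq_one, ← map_inv, ← map_mul]
  exact PresentedGroup.one_of_mem ⟨l, r, h, rfl⟩

/-- Values are classes of `K` modulo `Oˣ`, so `x` and `t α` of equal value differ by a unit. -/
lemma IsValueSection.exists_eq_unit_mul (ht : IsValueSection O K t) {x : O} (hx : ¬ IsUnit x)
    (hx0 : x ≠ 0) : ∃ α, α ≠ 0 ∧ α < 1 ∧ ∃ a : Oˣ, x = a * t α := by
  have hle : ValuationRing.valuation O K (algebraMap O K x) ≤ 1 :=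
    (ValuationRing.mem_integer_iff O K (algebraMap O K x)).2 ⟨x, rfl⟩
  have heq := ht.valuation_eq _ hle
  refine ⟨ValuationRing.valuation O K (algebraMap O K x), by simpa using hx0, lt_of_le_of_ne hle ?_, ?_⟩
  · intro h
    rw [← _root_.map_one (ValuationRing.valuation O K)] at h
    obtain ⟨c, hc⟩ := Quotient.exact h
    have hc' : algebraMap O K c = algebraMap O K x := by
      simpa [Units.smul_def, Algebra.smul_def] using hc
    exact hx (IsFractionRing.injective O K hc' ▸ c.isUnit)
  · obtain ⟨c, hc⟩ := Quotient.exact heq.symm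
    refine ⟨c, IsFractionRing.injective O K ?_⟩
    rw [map_mul]
    simpa [Units.smul_def, Algebra.smul_def] using hc.symm

/-- The class of the word `R(a)`, as a homomorphism. -/
noncomputable def classR (t : ValuationRing.ValueGroup O K → O) (𝔨 : Set Oˣ) :
    Oˣ →* PresentedGroup (relators O K t 𝔨) where
  toFun a := PresentedGroup.mk _ (wR a)
  map_one' := by rw [wR_one, map_one]
  map_mul' a b := by
    by_cases ha : a = 1
    · simp [ha, wR_one]
    by_cases hb : b = 1
    · simp [hb, wR_one]
    rw [← map_mul, (IsRelation.R_mul a b ha hb).mk_eq]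

/-- The classes of the words `R(a)`, `Z(a)`, `S`, `J` satisfy the relations. -/
noncomputable def relationSystem (ht : IsValueSection O K t)
    (h𝔨 : IsResidueRepresentatives O 𝔨) :
    RelationSystem O (PresentedGroup (relators O K t 𝔨)) where
  r := classR t 𝔨
  z :=
    { toFun a := PresentedGroup.mk _ (wZ a)
      map_one' := by rw [wZ_one, map_one]
      map_mul' a b := by
        by_cases ha : a = 1
        · simp [ha, wZ_one]
        by_cases hb : b = 1
        · simp [hb, wZ_one]
        rw [← map_mul, (IsRelation.Z_mul a b ha hb).mk_eq] }
  s := PresentedGroup.mk _ wS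
  j := PresentedGroup.mk _ wJ
  r_comm_z a b := by
    by_cases ha : a = 1
    · simp [ha]
    by_cases hb : b = 1
    · simp [hb, wZ_one]
    have := (IsRelation.comm_R_Z (K := K) (t := t) (𝔨 := 𝔨) a b ha hb).mk_eq
    rwa [map_commutatorElement, map_one, commutatorElement_eq_one_iff_commute] at this
  s_comm_z a := by
    by_cases ha : a = 1
    · simp [ha, wZ_one]
    have := (IsRelation.comm_S_Z (K := K) (t := t) (𝔨 := 𝔨) a ha).mk_eq
    rwa [map_commutatorElement, map_one, commutatorElement_eq_one_iff_commute] at this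
  s_mul_s := by
    rw [← pow_two, ← map_pow, IsRelation.S_sq.mk_eq, map_one]
  j_mul_j := by
    rw [← pow_two, ← map_pow, IsRelation.J_sq.mk_eq, map_one]
  js_cube := by
    rw [← map_mul, ← map_pow, IsRelation.JS_cube.mk_eq, map_one]
  jr_sq a := by
    by_cases ha : a = 1
    · simp only [ha, map_one, mul_one]
      rw [← map_pow, IsRelation.J_sq.mk_eq, map_one]
    · simp only [MonoidHom.coe_mk, OneHom.coe_mk]
      rw [wZ_of_ne ha, map_pow, map_mul]
      rfl
  conj_commutator x a u w hx hu hw := by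
    -- The value `∞` is excluded from the relations; there both commutators are trivial.
    by_cases hx0 : x = 0
    · have hu1 : u = 1 := by ext; simp [hu, hx0]
      have hw1 : w = 1 := by ext; simp [hw, hx0]
      simp [hu1, hw1]
    · obtain ⟨α, hα0, hα1, b, rfl⟩ := ht.exists_eq_unit_mul hx hx0
      have hα : ¬ IsUnit (t α) := by simpa using hx
      obtain ⟨v, hv⟩ := RelationSystem.isUnit_one_sub hα
      -- With `x = b * t α`, both commutators are conjugates of the one for `t α`, by `r b` and by
      -- `r (a * b)`.
      have key (c v' : Oˣ) (hv' : (v' : O) = 1 - c * t α) :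
          ⁅PresentedGroup.mk (relators O K t 𝔨) wS, PresentedGroup.mk (relators O K t 𝔨) (wR v')⁆ =
            PresentedGroup.mk _ (wR c) * ⁅PresentedGroup.mk (relators O K t 𝔨) wS,
              PresentedGroup.mk (relators O K t 𝔨) (wR v)⁆ * (PresentedGroup.mk _ (wR c))⁻¹ := by
        by_cases hc : c = 1
        · have : v' = v := by ext; simp [hv', hv, hc]
          simp [hc, this, wR_one]
        · have := (IsRelation.comm_S_R (K := K) (t := t) (𝔨 := 𝔨) α hα0 hα1 c hc v' v hv' hv).mk_eq
          simpa only [map_mul, map_inv, map_commutatorElement] using this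
      have hab (c d : Oˣ) : PresentedGroup.mk (relators O K t 𝔨) (wR (c * d)) =
          PresentedGroup.mk _ (wR c) * PresentedGroup.mk _ (wR d) := (classR t 𝔨).map_mul c d
      change ⁅_, PresentedGroup.mk _ (wR u)⁆ = PresentedGroup.mk _ (wR a) *
        ⁅_, PresentedGroup.mk _ (wR w)⁆ * (PresentedGroup.mk _ (wR a))⁻¹
      rw [key b w hw, key (a * b) u (by rw [hu, Units.val_mul, mul_assoc]), hab]
      group
  s_r_s a b hb := by
    have ha1 : IsLocalRing.residue O (a : O) ≠ 1 := by
      intro h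
      have := b.isUnit.map (IsLocalRing.residue O)
      simp [hb, h] at this
    have ha0 : IsLocalRing.residue O (a : O) ≠ 0 := (a.isUnit.map (IsLocalRing.residue O)).ne_zero
    obtain ⟨a₀, ha₀, h⟩ := h𝔨.surjOn ⟨ha0, ha1⟩
    simp only at h
    have hb₀ : IsUnit (1 - (a₀ : O)) := by
      rw [← IsLocalRing.residue_ne_zero_iff_isUnit, map_sub, map_one, h, sub_ne_zero]
      exact ha1.symm
    obtain ⟨b₀, hb₀⟩ := hb₀
    have hc₀ : ((-(b₀⁻¹ * a₀) : Oˣ) : O) * (a₀ - 1) = a₀ := by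
      have : (a₀ : O) - 1 = - b₀ := by rw [hb₀]; ring
      rw [this]
      push_cast
      linear_combination (a₀ : O) * b₀.inv_mul
    refine ⟨a₀, b₀, _, ?_, hb₀, hc₀, ?_⟩
    · rw [← IsLocalRing.residue_ne_zero_iff_isUnit, map_sub, h, sub_self]
      simp
    · have := (IsRelation.S_R_S (K := K) (t := t) (𝔨 := 𝔨) a₀ ha₀ b₀ _ hb₀ hc₀).mk_eq
      simp only [map_mul] at this
      exact this

end Presentation

end GL2Pres

open GL2Pres in
theorem theorem3p5 (O K : Type*) [CommRing O] [IsDomain O] [ValuationRing O]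
    [Field K] [Algebra O K] [IsFractionRing O K]
    (t : ValuationRing.ValueGroup O K → O) (ht : GL2Pres.IsValueSection O K t)
    (𝔨 : Set Oˣ) (h𝔨 : GL2Pres.IsResidueRepresentatives O 𝔨) :
    Subgroup.closure (Set.range (GL2Pres.Gen.toMatrix (O := O))) = ⊤ ∧
    ∃ φ : PresentedGroup (GL2Pres.relators O K t 𝔨) ≃* Matrix.GeneralLinearGroup (Fin 2) O,
      ∀ x : GL2Pres.Gen O, φ (PresentedGroup.of x) = x.toMatrix := by
  have hrel : ∀ x ∈ relators O K t 𝔨, FreeGroup.lift Gen.toMatrix x = 1 := by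
    rintro _ ⟨l, r, h, rfl⟩
    rw [map_mul, map_inv, h.lift_eq, mul_inv_cancel]
  let f := PresentedGroup.toGroup hrel
  let M := relationSystem ht h𝔨
  have hr (a : Oˣ) : f (M.r a) = Rmat a := lift_wR a
  have hs : f M.s = Smat := lift_wS
  have hj : f M.j = Jmat := lift_wJ
  have hsurj : Function.Surjective f := M.map_surjective hr hs hj
  have htop : Subgroup.closure (Set.range M.r ∪ {M.s, M.j}) = ⊤ := by
    rw [eq_top_iff, ← PresentedGroup.closure_range_of]
    refine Subgroup.closure_mono ?_
    rintro _ ⟨x, rfl⟩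
    cases x with
    | R a ha => exact Or.inl ⟨a, congrArg (PresentedGroup.mk _) (dif_neg ha)⟩
    | S => exact Or.inr (Or.inl rfl)
    | J => exact Or.inr (Or.inr rfl)
  have hinj : Function.Injective f := (injective_iff_map_eq_one f).2 fun g hg =>
    M.eq_one_of_isNormal hr hs hj (M.isNormal_of_closure_eq_top htop g) hg
  have hof (x : Gen O) : f (PresentedGroup.of x) = x.toMatrix := PresentedGroup.toGroup.of hrel
  refine ⟨?_, MulEquiv.ofBijective f ⟨hinj, hsurj⟩, hof⟩
  have hrange : Set.range (Gen.toMatrix (O := O)) = f '' Set.range PresentedGroup.of := by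
    rw [← Set.range_comp]
    exact congrArg Set.range (funext fun x => (hof x).symm)
  rw [hrange, ← MonoidHom.map_closure, PresentedGroup.closure_range_of,
    ← MonoidHom.range_eq_map, MonoidHom.range_eq_top.2 hsurj]
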